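/- Let $n\ge 1$ and let $P^*=(p_i^*)_{i=1}^n$ be a probability distribution with all $p_i^*>0$. A continuous-time Markov chain on $n$ states is given by rate constants $q_{ij}\ge 0$ ($i\neq j$; $q_{ij}$ is the rate of the transition $j\to i$), and its Kolmogorov equation for $P=(p_i)\in\mathbb{R}^n$ is $$\frac{\mathrm{d}p_i}{\mathrm{d}t}=\sum_{j\neq i}\,(q_{ij}p_j-q_{ji}p_i)\qquad(i=1,\ldots,n).$$ The chain has equilibrium $P^*$ if $\sum_{j\ne i}q_{ij}p_j^*=\bigl(\sum_{j\neq i}q_{ji}\bigr)p_i^*$ for all $i$, and it satisfies detailed balance with equilibrium $P^*$ if $q_{ij}p_j^*=q_{ji}p_i^*$ for all $i\ne j$. For a probability distribution $P^0$ (zero coordinates and coinciding ratios $p^0_i/p^*_i=p^0_j/p^*_j$ are allowed) let $\mathbf{Q}(P^0,P^*)\subset\mathbb{R}^n$ be the set of all velocities $\mathrm{d}P/\mathrm{d}t$ at the point $P^0$ of all Markov chains with equilibrium $P^*$, and let $\Phi(P^0)$ be the set of all values $P(t)$, $t>0$, of solutions with $P(0)=P^0$ of the Kolmogorov equations of all Markov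 chains that satisfy detailed balance with equilibrium $P^*$. Then for every probability distribution $P^0$ there exists a neighbourhood $U$ of $P^0$ in $\mathbb{R}^n$ such that $$\bigl(P^0+\mathbf{Q}(P^0,P^*)\bigr)\cap U=\Phi(P^0)\cap U.$$ -/

import Mathlib

namespace MarkovOrder

/-- Rate constants of a continuous-time Markov chain on `n` states: `q i j` (for `i ≠ j`) is the
rate constant of the transition `j → i`. Diagonal entries play no role. -/
def IsRates {n : ℕ} (q : Fin n → Fin n → ℝ) : Prop :=
  ∀ i j, i ≠ j → 0 ≤ q i j

/-- Right-hand side of the Kolmogorov (master) equation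
`dpᵢ/dt = ∑_{j ≠ i} (q_{ij} pⱼ - q_{ji} pᵢ)`. -/
def velocity {n : ℕ} (q : Fin n → Fin n → ℝ) (P : Fin n → ℝ) : Fin n → ℝ :=
  fun i => ∑ j ∈ Finset.univ.erase i, (q i j * P j - q j i * P i)

/-- Balance condition: `Pst` is an equilibrium of the chain with rate constants `q`. -/
def HasEquilibrium {n : ℕ} (q : Fin n → Fin n → ℝ) (Pst : Fin n → ℝ) : Prop :=
  ∀ i, ∑ j ∈ Finset.univ.erase i, q i j * Pst j
    = (∑ j ∈ Finset.univ.erase i, q j i) * Pst i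

/-- Detailed balance with respect to `Pst`. -/
def DetailedBalance {n : ℕ} (q : Fin n → Fin n → ℝ) (Pst : Fin n → ℝ) : Prop :=
  ∀ i j, q i j * Pst j = q j i * Pst i

/-- `Q(P, P*)`: the set of all velocities `dP/dt` at `P` of all Markov chains
(not necessarily with detailed balance) that have the equilibrium `Pst`. -/
def velocityCone {n : ℕ} (P Pst : Fin n → ℝ) : Set (Fin n → ℝ) :=
  {v | ∃ q : Fin n → Fin n → ℝ, IsRates q ∧ HasEquilibrium q Pst ∧ v = velocity q P}

/-- `P` is a solution, for times `t ≥ 0`, of the Kolmogorov equation with rate constants `q`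
and initial value `P0`. -/
def IsSolution {n : ℕ} (q : Fin n → Fin n → ℝ) (P0 : Fin n → ℝ) (P : ℝ → Fin n → ℝ) : Prop :=
  P 0 = P0 ∧ ∀ t, 0 ≤ t → HasDerivWithinAt P (velocity q (P t)) (Set.Ici 0) t

/-- `Φ(P0)`: the set of all values `P(t)`, `t > 0`, of solutions with `P(0) = P0` of all
Kolmogorov equations satisfying detailed balance with equilibrium `Pst`. -/
def reachable {n : ℕ} (P0 Pst : Fin n → ℝ) : Set (Fin n → ℝ) :=
  {x | ∃ q : Fin n → Fin n → ℝ, IsRates q ∧ DetailedBalance q Pst ∧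
    ∃ P : ℝ → Fin n → ℝ, IsSolution q P0 P ∧ ∃ t, 0 < t ∧ P t = x}

end MarkovOrder

/-!
Put `r i = pᵢ⁰ / pᵢ*`. Near `P⁰`, both sets coincide with the translate by `P⁰` of the cone
generated by the single transitions `i → j` with `r j < r i`.

*Velocities lie in the cone.* By the layer-cake decomposition, `P⁰` is a multiple of `P*` plus a
nonnegative combination of restrictions of `P*` to superlevel sets of `r`. A chain with equilibrium
`P*` only moves such a restriction out of its superlevel set, hence down the potential `r`.

*The cone is reachable.* Run exchanges `i ⇄ j` with rates `c_{ij} ≥ 0` over the pairs with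
`r j < r i`, and let `A` be the generator. Since `exp A - 1 = A φ(A)` with `φ(z) = (exp z - 1) / z`,
the displacement `exp A P⁰ - P⁰` has along `i → j` the coefficient `c_{ij}` times an analytic
function of `c` that is positive at `0`. The inverse function theorem therefore solves for `c` near
`0`, and the signs of `c` are those of the prescribed coefficients.

*Reachable displacements are velocities.* `exp A` is a stochastic matrix fixing `P*`, so `exp A - 1`
is the generator of another chain with equilibrium `P*`.
-/

open Topology Filter

namespace MarkovOrder

section ExpQuot

variable {𝔸 : Type*} [NormedRing 𝔸] [NormedAlgebra ℝ 𝔸]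

variable (𝔸) in
/-- The power series `∑ zᵏ / (k + 1)!` of `(exp z - 1) / z`, in a real normed algebra. -/
noncomputable def expQuotSeries : FormalMultilinearSeries ℝ 𝔸 𝔸 :=
  .ofScalars 𝔸 fun k => ((k + 1).factorial : ℝ)⁻¹

/-- The entire function `(exp z - 1) / z`, defined as the sum of its power series so that it makes
sense for non-invertible `z`. -/
noncomputable def expQuot (A : 𝔸) : 𝔸 :=
  (expQuotSeries 𝔸).sum A

@[simp]
lemma expQuot_zero : expQuot (0 : 𝔸) = 1 := by
  exact (FormalMultilinearSeries.ofScalarsSum_zero _).trans (by simp)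

lemma radius_expQuotSeries : (expQuotSeries 𝔸).radius = ⊤ := by
  refine FormalMultilinearSeries.ofScalars_radius_eq_top_of_tendsto 𝔸 _
    (.of_forall fun k => by positivity) ?_
  have hratio (k : ℕ) : ‖((k + 1 + 1).factorial : ℝ)⁻¹‖ / ‖((k + 1).factorial : ℝ)⁻¹‖ =
      ((k + 2 : ℕ) : ℝ)⁻¹ := by
    rw [Nat.factorial_succ (k + 1), norm_inv, norm_inv, Real.norm_natCast, Real.norm_natCast]
    push_cast
    field_simp
    ring
  simpa only [Nat.succ_eq_add_one, hratio] using
    (tendsto_add_atTop_iff_nat 2).2 (tendsto_inv_atTop_nhds_zero_nat (𝕜 := ℝ))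

variable [CompleteSpace 𝔸]

lemma hasFPowerSeriesOnBall_expQuot :
    HasFPowerSeriesOnBall (expQuot : 𝔸 → 𝔸) (expQuotSeries 𝔸) 0 ⊤ := by
  rw [← radius_expQuotSeries (𝔸 := 𝔸)]
  exact (expQuotSeries 𝔸).hasFPowerSeriesOnBall (by simp [radius_expQuotSeries])

lemma hasSum_expQuot (A : 𝔸) :
    HasSum (fun k : ℕ => ((k + 1).factorial : ℝ)⁻¹ • A ^ k) (expQuot A) := by
  simpa [expQuotSeries, FormalMultilinearSeries.ofScalars_apply_eq] using
    hasFPowerSeriesOnBall_expQuot.hasSum (y := A) (by simp)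

lemma analyticAt_expQuot (A : 𝔸) : AnalyticAt ℝ expQuot A :=
  hasFPowerSeriesOnBall_expQuot.analyticAt_of_mem (by simp)

lemma hasSum_exp_sub_one (A : 𝔸) :
    HasSum (fun k : ℕ => ((k + 1).factorial : ℝ)⁻¹ • A ^ (k + 1)) (NormedSpace.exp A - 1) := by
  simpa using (hasSum_nat_add_iff' 1).2 (NormedSpace.exp_series_hasSum_exp' (𝕂 := ℝ) A)

lemma mul_expQuot (A : 𝔸) : A * expQuot A = NormedSpace.exp A - 1 := by
  refine ((hasSum_expQuot A).mul_left A).unique ?_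
  simpa only [pow_succ', mul_smul_comm] using hasSum_exp_sub_one A

lemma expQuot_mul (A : 𝔸) : expQuot A * A = NormedSpace.exp A - 1 := by
  refine ((hasSum_expQuot A).mul_right A).unique ?_
  simpa only [pow_succ, smul_mul_assoc] using hasSum_exp_sub_one A

end ExpQuot

lemma mem_hull_range_iff {R M E : Type*} [Semiring R] [PartialOrder R] [IsOrderedRing R]
    [AddCommMonoid M] [Module R M] [Fintype E] {γ : E → M} {v : M} :
    v ∈ PointedCone.hull R (Set.range γ) ↔ ∃ w : E → R, 0 ≤ w ∧ ∑ e, w e • γ e = v := by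
  rw [Submodule.mem_span_range_iff_exists_fun]
  constructor
  · rintro ⟨w, rfl⟩
    exact ⟨fun e => w e, fun e => (w e).2, rfl⟩
  · rintro ⟨w, hw, rfl⟩
    exact ⟨fun e => ⟨w e, hw e⟩, rfl⟩

section LocalInversion

variable {E : Type*} [Fintype E]

lemma eventually_exists_nonneg_mul_eq {g : E → (E → ℝ) → ℝ}
    (hg : ∀ e, ContDiffAt ℝ 1 (g e) 0) (hpos : ∀ e, 0 < g e 0) :
    ∀ᶠ w in 𝓝 (0 : E → ℝ), 0 ≤ w → ∃ c : E → ℝ, 0 ≤ c ∧ ∀ e, c e * g e c = w e := by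
  let G : (E → ℝ) → E → ℝ := fun c e => c e * g e c
  let D : (E → ℝ) →L[ℝ] (E → ℝ) := .pi fun e => g e 0 • .proj e
  have hG : HasStrictFDerivAt G D 0 := by
    refine hasStrictFDerivAt_pi'.2 fun e => ?_
    refine ((hasStrictFDerivAt_apply e 0).mul
      ((hg e).hasStrictFDerivAt one_ne_zero)).congr_fderiv ?_
    ext1 w
    simp [D]
  have hD : D.range = ⊤ := LinearMap.range_eq_top.2 fun w =>
    ⟨fun e => w e / g e 0, funext fun e => by simp [D, mul_div_cancel₀ _ (hpos e).ne']⟩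
  have hnear : ∀ᶠ c in 𝓝 (0 : E → ℝ), ∀ e, 0 < g e c :=
    eventually_all.2 fun e => (hg e).continuousAt.eventually_const_lt (hpos e)
  have himage : ∀ᶠ w in 𝓝 (G 0), ∃ c, (∀ e, 0 < g e c) ∧ G c = w := by
    rw [← hG.map_nhds_eq_of_surj hD]
    exact image_mem_map hnear
  have hG0 : G 0 = 0 := funext fun e => zero_mul _
  rw [hG0] at himage
  filter_upwards [himage] with w ⟨c, hc, hcw⟩ hw
  exact ⟨c, fun e => nonneg_of_mul_nonneg_left ((hw e).trans_eq (congrFun hcw e).symm) (hc e),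
    congrFun hcw⟩

variable {V : Type*} [NormedAddCommGroup V] [NormedSpace ℝ V]

lemma eventually_forall_nonneg_coeff {γ : E → V} {f : V →L[ℝ] ℝ} (hf : ∀ e, 0 < f (γ e))
    {p : (E → ℝ) → Prop} (hp : ∀ᶠ w in 𝓝 0, p w) :
    ∀ᶠ v in 𝓝 (0 : V), ∀ w : E → ℝ, 0 ≤ w → ∑ e, w e • γ e = v → p w := by
  obtain ⟨ε, hε, hball⟩ := Metric.eventually_nhds_iff_ball.1 hp
  have hsmall : ∀ᶠ v in 𝓝 (0 : V), ∀ e, f v < ε * f (γ e) := eventually_all.2 fun e =>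
    f.continuous.continuousAt.eventually_lt_const (by simpa using mul_pos hε (hf e))
  filter_upwards [hsmall] with v hv w hw hwv
  refine hball w ((dist_pi_lt_iff hε).2 fun e => ?_)
  rw [Pi.zero_apply, dist_zero_right, Real.norm_of_nonneg (hw e)]
  refine lt_of_mul_lt_mul_right (lt_of_le_of_lt ?_ (hv e)) (hf e).le
  calc w e * f (γ e) ≤ ∑ e, w e * f (γ e) := Finset.single_le_sum
        (f := fun e => w e * f (γ e)) (fun e _ => mul_nonneg (hw e) (hf e).le) (Finset.mem_univ e)
    _ = f v := by simp [← hwv]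

variable [CompleteSpace V]

theorem eventually_exists_exp_apply_eq {l : E → V →L[ℝ] ℝ} {γ : E → V} {x : V}
    (hl : ∀ e, 0 < l e x) {f : V →L[ℝ] ℝ} (hf : ∀ e, 0 < f (γ e)) :
    ∀ᶠ y in 𝓝 x, y - x ∈ PointedCone.hull ℝ (Set.range γ) →
      ∃ c : E → ℝ, 0 ≤ c ∧ NormedSpace.exp (∑ e, c e • (l e).smulRight (γ e)) x = y := by
  let A : (E → ℝ) → V →L[ℝ] V := fun c => ∑ e, c e • (l e).smulRight (γ e)
  have hA0 : A 0 = 0 := by simp [A]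
  let g : E → (E → ℝ) → ℝ := fun e c => l e (expQuot (A c) x)
  have hg : ∀ e, ContDiffAt ℝ 1 (g e) 0 := fun e => by
    have hexpQuot : ContDiffAt ℝ 1 expQuot (A 0) := (analyticAt_expQuot _).contDiffAt
    have hA : ContDiffAt ℝ 1 A 0 := by fun_prop
    exact (l e).contDiff.contDiffAt.comp _ ((hexpQuot.comp _ hA).clm_apply contDiffAt_const)
  have hg0 : ∀ e, 0 < g e 0 := fun e => by simpa [g, hA0] using hl e
  have hexp : ∀ c, NormedSpace.exp (A c) x = x + ∑ e, (c e * g e c) • γ e := fun c => by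
    have h := congrArg (fun B : V →L[ℝ] V => B x) (mul_expQuot (A c))
    simp only [mul_apply_eq_comp, sub_apply, one_apply_eq_self] at h
    rw [← sub_eq_iff_eq_add', ← h]
    simp [A, g, mul_smul]
  have hsub : Tendsto (fun y => y - x) (𝓝 x) (𝓝 0) := tendsto_sub_nhds_zero_iff.2 tendsto_id
  filter_upwards [hsub.eventually (eventually_forall_nonneg_coeff hf
    (eventually_exists_nonneg_mul_eq hg hg0))] with y hy hyx
  obtain ⟨w, hw, hwy⟩ := mem_hull_range_iff.1 hyx
  obtain ⟨c, hc, hcw⟩ := hy w hw hwy hw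
  exact ⟨c, hc, by rw [hexp]; simp only [hcw, hwy, add_sub_cancel]⟩

end LocalInversion

section Transfer

variable {ι : Type*} [DecidableEq ι] {r : ι → ℝ}

/-- The direction of the elementary transition `i → j`: unit mass leaves state `i` and enters
state `j`. -/
def transfer (i j : ι) : ι → ℝ := Pi.single j 1 - Pi.single i 1

/-- The cone generated by the transitions `i → j` along which the potential `r` strictly decreases.
For `r i = pᵢ / pᵢ*` it contains all velocities at `P` of chains with equilibrium `P*`. -/
def transferCone (r : ι → ℝ) : PointedCone ℝ (ι → ℝ) :=
  .hull ℝ (Set.range fun e : {e : ι × ι // r e.2 < r e.1} => transfer e.1.1 e.1.2)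

lemma transfer_mem_transferCone {i j : ι} (h : r j < r i) : transfer i j ∈ transferCone r :=
  PointedCone.subset_hull ⟨⟨(i, j), h⟩, rfl⟩

variable [Fintype ι]

lemma sum_sum_mul_smul_transfer (a b : ι → ℝ) :
    ∑ i, ∑ j, (a i * b j) • transfer i j = (∑ i, a i) • b - (∑ j, b j) • a := by
  funext k
  simp [transfer, Pi.single_apply, mul_sub, Finset.sum_sub_distrib, ← Finset.mul_sum,
    ← Finset.sum_mul, mul_comm]

lemma mem_transferCone_of_sum_eq_zero {u : ι → ℝ} (hsum : ∑ i, u i = 0)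
    (hdown : ∀ i j, u i < 0 → 0 < u j → r j < r i) : u ∈ transferCone r := by
  have hmass : ∑ i, u⁻ i = ∑ i, u⁺ i := by
    rw [eq_comm, ← sub_eq_zero, ← Finset.sum_sub_distrib, ← hsum]
    exact Finset.sum_congr rfl fun i _ => congrFun (posPart_sub_negPart u) i
  rcases (Fintype.sum_nonneg (posPart_nonneg u)).eq_or_lt' with h0 | hpos
  · have hplus : u⁺ = 0 := (Fintype.sum_eq_zero_iff_of_nonneg (posPart_nonneg u)).1 h0
    have hminus : u⁻ = 0 :=
      (Fintype.sum_eq_zero_iff_of_nonneg (negPart_nonneg u)).1 (hmass.trans h0)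
    rw [← posPart_sub_negPart u, hplus, hminus, sub_zero]
    exact zero_mem _
  rw [← (transferCone r).smul_mem_iff hpos]
  -- Transport the negative part to the positive part, each source serving all targets
  -- proportionally.
  have hplan : (∑ i, u⁺ i) • u = ∑ i, ∑ j, (u⁻ i * u⁺ j) • transfer i j := by
    rw [sum_sum_mul_smul_transfer, hmass, ← smul_sub, posPart_sub_negPart]
  rw [hplan]
  refine sum_mem fun i _ => sum_mem fun j _ => ?_
  rcases le_or_gt 0 (u i) with hi | hi
  · simp [hi]
  rcases le_or_gt (u j) 0 with hj | hj
  · simp [hj]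
  · exact (transferCone r).smul_mem (mul_nonneg (negPart_nonneg u i) (posPart_nonneg u j))
      (transfer_mem_transferCone (hdown i j hi hj))

end Transfer

lemma exists_eq_add_sum_filter_le {α : Type*} [AddCommGroup α] [LinearOrder α]
    [IsOrderedAddMonoid α] (s : Finset α) :
    ∃ (b : α) (c : α → α), 0 ≤ c ∧ ∀ x ∈ s, x = b + ∑ t ∈ s with t ≤ x, c t := by
  induction s using Finset.induction_on_max with
  | empty => exact ⟨0, 0, le_rfl, by simp⟩
  | insert a s hlt ih =>
    obtain ⟨b, c, hc, hs⟩ := ih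
    have ha : a ∉ s := fun h => lt_irrefl a (hlt a h)
    rcases s.eq_empty_or_nonempty with rfl | hne
    · exact ⟨a, 0, le_rfl, by simp⟩
    set m := s.max' hne
    have hm : m = b + ∑ t ∈ s, c t := by
      rw [hs m (s.max'_mem hne), Finset.filter_true_of_mem s.le_max']
    refine ⟨b, Function.update c a (a - m), ?_, ?_⟩
    · exact le_update_iff.2 ⟨sub_nonneg.2 (hlt m (s.max'_mem hne)).le, fun t _ => hc t⟩
    have hupdate : ∀ u ⊆ s, ∑ t ∈ u, Function.update c a (a - m) t = ∑ t ∈ u, c t := fun u hu =>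
      Finset.sum_update_of_notMem (fun h => ha (hu h)) _ _
    intro x hx
    rcases Finset.mem_insert.1 hx with rfl | hxs
    · rw [Finset.filter_insert, if_pos le_rfl, Finset.filter_true_of_mem fun t ht => (hlt t ht).le,
        Finset.sum_insert ha, Function.update_self, hupdate s subset_rfl, add_left_comm, ← hm,
        sub_add_cancel]
    · rw [Finset.filter_insert, if_neg (hlt x hxs).not_ge, hupdate _ (Finset.filter_subset _ s)]
      exact hs x hxs

section Velocity

variable {n : ℕ}

lemma velocity_apply (q : Fin n → Fin n → ℝ) (P : Fin n → ℝ) (i : Fin n) :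
    velocity q P i = ∑ j, q i j * P j - (∑ j, q j i) * P i := by
  rw [Finset.sum_mul, ← Finset.sum_sub_distrib]
  exact Finset.sum_erase _ (sub_self _)

lemma sum_velocity (q : Fin n → Fin n → ℝ) (P : Fin n → ℝ) : ∑ i, velocity q P i = 0 := by
  simp only [velocity_apply, Finset.sum_sub_distrib, Finset.sum_mul]
  rw [sub_eq_zero, Finset.sum_comm]

lemma hasEquilibrium_iff {q : Fin n → Fin n → ℝ} {P : Fin n → ℝ} :
    HasEquilibrium q P ↔ velocity q P = 0 := by
  simp only [HasEquilibrium, funext_iff, velocity, Finset.sum_sub_distrib, Finset.sum_mul,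
    Pi.zero_apply, sub_eq_zero]

lemma DetailedBalance.hasEquilibrium {q : Fin n → Fin n → ℝ} {P : Fin n → ℝ}
    (h : DetailedBalance q P) : HasEquilibrium q P :=
  hasEquilibrium_iff.2 <| funext fun _ => Finset.sum_eq_zero fun j _ => sub_eq_zero.2 (h _ j)

/-- The right-hand side of the Kolmogorov equation as a continuous linear operator on
distributions, depending linearly on the rate constants. -/
noncomputable def generator :
    (Fin n → Fin n → ℝ) →ₗ[ℝ] (Fin n → ℝ) →L[ℝ] (Fin n → ℝ) :=
  LinearMap.toContinuousLinearMap.toLinearMap ∘ₗ LinearMap.mk₂ ℝ velocity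
    (fun q q' P => by
      ext; simp only [velocity_apply, Pi.add_apply, add_mul, Finset.sum_add_distrib]; ring)
    (fun c q P => by
      ext; simp only [velocity_apply, Pi.smul_apply, smul_eq_mul, mul_assoc, ← Finset.mul_sum]
      ring)
    (fun q P P' => by
      ext; simp only [velocity_apply, Pi.add_apply, mul_add, Finset.sum_add_distrib]; ring)
    (fun c q P => by
      ext; simp only [velocity_apply, Pi.smul_apply, smul_eq_mul, mul_left_comm, ← Finset.mul_sum]
      ring)

@[simp]
lemma generator_apply (q : Fin n → Fin n → ℝ) (P : Fin n → ℝ) :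
    generator q P = velocity q P := rfl

lemma velocity_indicator_mem_transferCone {q : Fin n → Fin n → ℝ} (hq : IsRates q)
    {Pst : Fin n → ℝ} (hnonneg : 0 ≤ Pst) (heq : HasEquilibrium q Pst) (r : Fin n → ℝ) (t : ℝ) :
    velocity q ({i | t ≤ r i}.indicator Pst) ∈ transferCone r := by
  set A : Set (Fin n) := {i | t ≤ r i}
  have hle : ∀ j, A.indicator Pst j ≤ Pst j := fun j =>
    Set.indicator_le_self' (fun _ _ => hnonneg _) j
  have hge : ∀ j, 0 ≤ A.indicator Pst j := fun j => Set.indicator_nonneg (fun _ _ => hnonneg _) j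
  have hin : ∀ i ∈ A, velocity q (A.indicator Pst) i ≤ 0 := fun i hi => by
    refine (Finset.sum_le_sum fun j hj => sub_le_sub ?_ ?_).trans_eq
      (congrFun (hasEquilibrium_iff.1 heq) i)
    · exact mul_le_mul_of_nonneg_left (hle j) (hq i j (Finset.ne_of_mem_erase hj).symm)
    · rw [Set.indicator_of_mem hi]
  have hout : ∀ i ∉ A, 0 ≤ velocity q (A.indicator Pst) i := fun i hi =>
    Finset.sum_nonneg fun j hj => by
      rw [Set.indicator_of_notMem hi, mul_zero, sub_zero]
      exact mul_nonneg (hq i j (Finset.ne_of_mem_erase hj).symm) (hge j)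
  refine mem_transferCone_of_sum_eq_zero (sum_velocity q _) fun i j hi hj => ?_
  have hiA : i ∈ A := by_contra fun h => (hout i h).not_gt hi
  have hjA : j ∉ A := fun h => (hin j h).not_gt hj
  exact (not_le.1 hjA).trans_le hiA

lemma velocityCone_subset_transferCone {Pst : Fin n → ℝ} (hpos : ∀ i, 0 < Pst i)
    (P : Fin n → ℝ) : velocityCone P Pst ⊆ transferCone (P / Pst) := by
  rintro _ ⟨q, hq, heq, rfl⟩
  obtain ⟨b, c, hc, hr⟩ := exists_eq_add_sum_filter_le (Finset.univ.image (P / Pst))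
  have hP : P = b • Pst + ∑ t ∈ Finset.univ.image (P / Pst),
      c t • {i | t ≤ (P / Pst) i}.indicator Pst := by
    funext i
    have hi := hr ((P / Pst) i) (Finset.mem_image_of_mem _ (Finset.mem_univ i))
    calc P i = (P / Pst) i * Pst i := (div_mul_cancel₀ _ (hpos i).ne').symm
      _ = _ := by
        rw [hi]
        simp [add_mul, Finset.sum_mul, Finset.sum_filter, Set.indicator_apply, ite_mul]
  have hvel : velocity q P = ∑ t ∈ Finset.univ.image (P / Pst),
      c t • velocity q ({i | t ≤ (P / Pst) i}.indicator Pst) := by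
    conv_lhs => rw [hP]
    simp only [← generator_apply, map_add, map_smul, map_sum]
    rw [generator_apply, hasEquilibrium_iff.1 heq, smul_zero, zero_add]
  rw [hvel]
  exact sum_mem fun t _ => (transferCone _).smul_mem (hc t)
    (velocity_indicator_mem_transferCone hq (fun i => (hpos i).le) heq _ t)

lemma IsRates.sum_smul {E : Type*} [Fintype E] {q : E → Fin n → Fin n → ℝ} {c : E → ℝ}
    (hq : ∀ e, IsRates (q e)) (hc : 0 ≤ c) : IsRates (∑ e, c e • q e) := fun i j hij => by
  simp only [Finset.sum_apply, Pi.smul_apply, smul_eq_mul]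
  exact Finset.sum_nonneg fun e _ => mul_nonneg (hc e) (hq e i j hij)

lemma DetailedBalance.sum_smul {E : Type*} [Fintype E] {q : E → Fin n → Fin n → ℝ}
    {Pst : Fin n → ℝ} (hq : ∀ e, DetailedBalance (q e) Pst) (c : E → ℝ) :
    DetailedBalance (∑ e, c e • q e) Pst := fun i j => by
  simp only [Finset.sum_apply, Pi.smul_apply, smul_eq_mul, Finset.sum_mul, mul_assoc, hq _ i j]

/-- The reversible two-state exchange `i ⇄ j`, with the rates normalized so that the equilibrium
flux is one in each direction. For `i = j` it consists of an irrelevant diagonal rate. -/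
noncomputable def exchangeRates (Pst : Fin n → ℝ) (i j : Fin n) : Fin n → Fin n → ℝ :=
  Pi.single j (Pi.single i (Pst i)⁻¹) + Pi.single i (Pi.single j (Pst j)⁻¹)

lemma isRates_exchangeRates {Pst : Fin n → ℝ} (hnonneg : 0 ≤ Pst) (i j : Fin n) :
    IsRates (exchangeRates Pst i j) := by
  have h : 0 ≤ exchangeRates Pst i j := add_nonneg
    (Pi.single_nonneg.2 <| Pi.single_nonneg.2 <| inv_nonneg.2 (hnonneg i))
    (Pi.single_nonneg.2 <| Pi.single_nonneg.2 <| inv_nonneg.2 (hnonneg j))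
  exact fun a b _ => h a b

lemma detailedBalance_exchangeRates {Pst : Fin n → ℝ} (hne : ∀ i, Pst i ≠ 0) (i j : Fin n) :
    DetailedBalance (exchangeRates Pst i j) Pst := fun a b => by
  by_cases i = a <;> by_cases j = a <;> by_cases i = b <;> by_cases j = b <;>
    simp_all [exchangeRates]

lemma generator_single_single (i j : Fin n) (k : ℝ) :
    generator (Pi.single j (Pi.single i k)) =
      (k • ContinuousLinearMap.proj (R := ℝ) i).smulRight (transfer i j) := by
  ext P a
  have hfrom : (if a = i then k * P a else 0) = if a = i then k * P i else 0 :=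
    ite_congr rfl (fun h => by rw [h]) fun _ => rfl
  simp [velocity_apply, transfer, Pi.single_apply, ite_apply, mul_sub, hfrom]

lemma generator_exchangeRates (Pst : Fin n → ℝ) (i j : Fin n) :
    generator (exchangeRates Pst i j) =
      ((Pst i)⁻¹ • ContinuousLinearMap.proj (R := ℝ) (φ := fun _ => ℝ) i -
        (Pst j)⁻¹ • ContinuousLinearMap.proj j).smulRight (transfer i j) := by
  rw [exchangeRates, map_add, generator_single_single, generator_single_single]
  ext P a
  simp only [transfer, add_apply, ContinuousLinearMap.smulRight_apply, smul_apply,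
    ContinuousLinearMap.proj_apply, smul_eq_mul, Pi.add_apply, Pi.smul_apply, Pi.sub_apply,
    sub_apply]
  ring

end Velocity

lemma exp_add_smul_one {𝔸 : Type*} [NormedRing 𝔸] [NormedAlgebra ℝ 𝔸] [CompleteSpace 𝔸]
    (A : 𝔸) (c : ℝ) :
    NormedSpace.exp (A + c • (1 : 𝔸)) = Real.exp c • NormedSpace.exp A := by
  let : NormedAlgebra ℚ 𝔸 := NormedAlgebra.restrictScalars ℚ ℝ 𝔸
  rw [NormedSpace.exp_add_of_commute ((Commute.one_right A).smul_right c),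
    ← Algebra.algebraMap_eq_smul_one, ← NormedSpace.algebraMap_exp_comm, ← Real.exp_eq_exp_ℝ,
    Algebra.algebraMap_eq_smul_one, mul_smul_one]

section LinearFlow

variable {V : Type*} [NormedAddCommGroup V] [NormedSpace ℝ V] [CompleteSpace V]

lemma hasDerivAt_exp_smul_apply (A : V →L[ℝ] V) (x : V) (t : ℝ) :
    HasDerivAt (fun s : ℝ => NormedSpace.exp (s • A) x) (A (NormedSpace.exp (t • A) x)) t :=
  ((ContinuousLinearMap.apply ℝ V x).hasFDerivAt.comp_hasDerivAt t
    (hasDerivAt_exp_smul_const' A t) :)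

lemma exp_apply_mem {A : V →L[ℝ] V} {C : ProperCone ℝ V} (hA : ∀ x ∈ C, A x ∈ C) {x : V}
    (hx : x ∈ C) : NormedSpace.exp A x ∈ C := by
  have hsum : HasSum (fun k : ℕ => (k.factorial : ℝ)⁻¹ • (A ^ k) x) (NormedSpace.exp A x) := by
    simpa using (NormedSpace.exp_series_hasSum_exp' (𝕂 := ℝ) A).mapL
      (ContinuousLinearMap.apply ℝ V x)
  have hpow : ∀ k : ℕ, (A ^ k) x ∈ C := fun k => by
    rw [pow_apply_eq_iterate]
    exact (show Set.MapsTo A C C from hA).iterate k hx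
  rw [← hsum.tsum_eq]
  exact tsum_mem C.isClosed fun k => C.smul_mem (hpow k) (by positivity)

lemma exp_apply_mem_of_add_smul_one {A : V →L[ℝ] V} {C : ProperCone ℝ V} {c : ℝ}
    (hA : ∀ x ∈ C, (A + c • (1 : V →L[ℝ] V)) x ∈ C) {x : V} (hx : x ∈ C) :
    NormedSpace.exp A x ∈ C := by
  have h : NormedSpace.exp A = Real.exp (-c) • NormedSpace.exp (A + c • (1 : V →L[ℝ] V)) := by
    rw [← exp_add_smul_one, neg_smul, add_neg_cancel_right]
  rw [h]
  exact C.smul_mem (exp_apply_mem hA hx) (Real.exp_nonneg _)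

end LinearFlow

section Reachable

variable {n : ℕ} {q : Fin n → Fin n → ℝ} {P0 Pst : Fin n → ℝ}

lemma isSolution_exp (q : Fin n → Fin n → ℝ) (P0 : Fin n → ℝ) :
    IsSolution q P0 fun t => NormedSpace.exp (t • generator q) P0 :=
  ⟨by simp, fun t _ => (hasDerivAt_exp_smul_apply (generator q) P0 t).hasDerivWithinAt⟩

lemma IsSolution.eq_exp {P : ℝ → Fin n → ℝ} (h : IsSolution q P0 P) {t : ℝ} (ht : 0 ≤ t) :
    P t = NormedSpace.exp (t • generator q) P0 := by
  have hexp : ∀ s, HasDerivAt (fun s => NormedSpace.exp (s • generator q) P0) _ s :=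
    hasDerivAt_exp_smul_apply (generator q) P0
  refine ODE_solution_unique (v := fun _ => generator q) (a := 0) (b := t)
    (fun _ => (generator q).lipschitz)
    (fun s hs => (h.2 s hs.1).continuousWithinAt.mono fun _ hx => hx.1)
    (fun s hs => (h.2 s hs.1).mono (Set.Ici_subset_Ici.2 hs.1))
    (fun s _ => (hexp s).continuousAt.continuousWithinAt)
    (fun s _ => (hexp s).hasDerivWithinAt) ?_ ⟨ht, le_rfl⟩
  simp [h.1]

lemma mem_reachable_iff {x : Fin n → ℝ} :
    x ∈ reachable P0 Pst ↔
      ∃ q, IsRates q ∧ DetailedBalance q Pst ∧ NormedSpace.exp (generator q) P0 = x := by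
  constructor
  · rintro ⟨q, hq, hdb, P, hP, t, ht, rfl⟩
    refine ⟨t • q, fun i j hij => mul_nonneg ht.le (hq i j hij), fun i j => ?_, ?_⟩
    · simp only [Pi.smul_apply, smul_eq_mul, mul_assoc, hdb i j]
    · rw [map_smul, hP.eq_exp ht.le]
  · rintro ⟨q, hq, hdb, rfl⟩
    exact ⟨q, hq, hdb, _, isSolution_exp q P0, 1, one_pos, by rw [one_smul]⟩

theorem eventually_mem_reachable_of_sub_mem_transferCone (hpos : ∀ i, 0 < Pst i)
    (P0 : Fin n → ℝ) :
    ∀ᶠ x in 𝓝 P0, x - P0 ∈ transferCone (P0 / Pst) → x ∈ reachable P0 Pst := by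
  set r := P0 / Pst with hr
  let imbalance : {e : Fin n × Fin n // r e.2 < r e.1} → (Fin n → ℝ) →L[ℝ] ℝ := fun e =>
    (Pst e.1.1)⁻¹ • .proj e.1.1 - (Pst e.1.2)⁻¹ • .proj e.1.2
  let height : (Fin n → ℝ) →L[ℝ] ℝ := -∑ k, r k • .proj k
  have himbalance : ∀ e, 0 < imbalance e P0 := fun e => by
    simpa [imbalance, hr, div_eq_inv_mul] using e.2
  have hheight : ∀ e : {e : Fin n × Fin n // r e.2 < r e.1},
      0 < height (transfer e.1.1 e.1.2) := fun e => by
    simpa [height, transfer, mul_sub, Pi.single_apply] using e.2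
  filter_upwards [eventually_exists_exp_apply_eq himbalance hheight] with x hx hcone
  obtain ⟨c, hc, hcx⟩ := hx hcone
  refine mem_reachable_iff.2 ⟨∑ e, c e • exchangeRates Pst e.1.1 e.1.2,
    .sum_smul (fun e => isRates_exchangeRates (fun i => (hpos i).le) _ _) hc,
    .sum_smul (fun e => detailedBalance_exchangeRates (fun i => (hpos i).ne') _ _) c, ?_⟩
  simpa only [map_sum, map_smul, generator_exchangeRates] using hcx

lemma IsRates.exp_generator_apply_nonneg (hq : IsRates q) {x : Fin n → ℝ} (hx : 0 ≤ x) :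
    0 ≤ NormedSpace.exp (generator q) x := by
  -- `c` bounds all exit rates, so `generator q + c` has nonnegative entries.
  obtain ⟨c, hc⟩ := (Set.finite_range fun i => ∑ j ∈ Finset.univ.erase i, q j i).bddAbove
  refine exp_apply_mem_of_add_smul_one (C := .positive ℝ (Fin n → ℝ)) (c := c)
    (fun x (hx : 0 ≤ x) i => ?_) hx
  have hin : 0 ≤ ∑ j ∈ Finset.univ.erase i, q i j * x j := Finset.sum_nonneg fun j hj =>
    mul_nonneg (hq i j (Finset.ne_of_mem_erase hj).symm) (hx j)
  have hout : (∑ j ∈ Finset.univ.erase i, q j i) * x i ≤ c * x i :=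
    mul_le_mul_of_nonneg_right (hc (Set.mem_range_self i)) (hx i)
  have hvelocity : velocity q x i = ∑ j ∈ Finset.univ.erase i, q i j * x j -
      (∑ j ∈ Finset.univ.erase i, q j i) * x i := by
    rw [velocity, Finset.sum_sub_distrib, Finset.sum_mul]
  calc 0 ≤ velocity q x i + c * x i := by linarith
    _ = (generator q + c • 1) x i := by simp

lemma sum_exp_generator_apply (q : Fin n → Fin n → ℝ) (x : Fin n → ℝ) :
    ∑ i, NormedSpace.exp (generator q) x i = ∑ i, x i := by
  have h := sum_velocity q (expQuot (generator q) x)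
  rw [← generator_apply, ← mul_apply_eq_comp, mul_expQuot] at h
  simpa [sub_eq_zero] using h

lemma HasEquilibrium.exp_generator_apply (h : HasEquilibrium q Pst) :
    NormedSpace.exp (generator q) Pst = Pst := by
  rw [← sub_eq_zero]
  calc NormedSpace.exp (generator q) Pst - Pst
      = (expQuot (generator q) * generator q) Pst := by rw [expQuot_mul]; rfl
    _ = 0 := by
      rw [mul_apply_eq_comp, generator_apply, hasEquilibrium_iff.1 h, map_zero]

lemma sub_mem_velocityCone_of_stochastic {S : (Fin n → ℝ) →ₗ[ℝ] (Fin n → ℝ)}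
    (hnonneg : ∀ x, 0 ≤ x → 0 ≤ S x) (hsum : ∀ x, ∑ i, S x i = ∑ i, x i)
    (hfix : S Pst = Pst) (P : Fin n → ℝ) : S P - P ∈ velocityCone P Pst := by
  let q : Fin n → Fin n → ℝ := fun i j => S (Pi.single j 1) i
  have hvelocity : ∀ x, velocity q x = S x - x := fun x => by
    funext i
    have hrow : S x i = ∑ j, q i j * x j := by
      conv_lhs => rw [pi_eq_sum_univ' x, map_sum]
      simp [q, mul_comm]
    have hcol : ∑ j, q j i = 1 := by simp [q, hsum]
    rw [velocity_apply, ← hrow, hcol, one_mul, Pi.sub_apply]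
  refine ⟨q, fun i j _ => hnonneg _ (Pi.single_nonneg.2 zero_le_one) i, ?_,
    (hvelocity P).symm⟩
  rw [hasEquilibrium_iff, hvelocity, hfix, sub_self]

theorem sub_mem_velocityCone_of_mem_reachable {x : Fin n → ℝ} (hx : x ∈ reachable P0 Pst) :
    x - P0 ∈ velocityCone P0 Pst := by
  obtain ⟨q, hq, hdb, rfl⟩ := mem_reachable_iff.1 hx
  exact sub_mem_velocityCone_of_stochastic (S := (NormedSpace.exp (generator q)).toLinearMap)
    (fun _ => hq.exp_generator_apply_nonneg) (sum_exp_generator_apply q)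
    hdb.hasEquilibrium.exp_generator_apply P0

end Reachable

end MarkovOrder

theorem proposition2_general (n : ℕ) (Pst P0 : Fin n → ℝ) (hpos : ∀ i, 0 < Pst i) :
    ∃ U ∈ nhds P0,
      ((fun v => P0 + v) '' MarkovOrder.velocityCone P0 Pst) ∩ U
        = MarkovOrder.reachable P0 Pst ∩ U := by
  refine ⟨_, MarkovOrder.eventually_mem_reachable_of_sub_mem_transferCone hpos P0,
    Set.Subset.antisymm ?_ ?_⟩
  · rintro _ ⟨⟨v, hv, rfl⟩, hU⟩
    refine ⟨hU ?_, hU⟩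
    rw [add_sub_cancel_left]
    exact MarkovOrder.velocityCone_subset_transferCone hpos P0 hv
  · rintro x ⟨hx, hU⟩
    exact ⟨⟨x - P0, MarkovOrder.sub_mem_velocityCone_of_mem_reachable hx, add_sub_cancel P0 x⟩, hU⟩

theorem proposition2 (n : ℕ) (Pst P0 : Fin n → ℝ)
    (hPst : Pst ∈ stdSimplex ℝ (Fin n)) (hpos : ∀ i, 0 < Pst i)
    (hP0 : P0 ∈ stdSimplex ℝ (Fin n)) :
    ∃ U ∈ nhds P0,
      ((fun v => P0 + v) '' MarkovOrder.velocityCone P0 Pst) ∩ U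
        = MarkovOrder.reachable P0 Pst ∩ U :=
  proposition2_general n Pst P0 hpos
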